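/- Let $T, W \ge 1$ be integers with $T \ge 2$ unless $W = 1$. Consider the absorbing Markov chain whose transient states are $s_t^i$ ($1 \le t \le T$, $1 \le i \le W$; layer $t$ is $\{s_t^1, \dots, s_t^W\}$) and whose absorbing states are $0$ and $1$: from any state of a layer $t < T$ the chain moves to each state of layer $t+1$ with probability $1/W$, and from any state of layer $T$ it moves to each of the two absorbing states with probability $1/2$. Let $p^\star_{mk}$ be the probability of being absorbed in $k$ when starting from $m$. Let $(\boldsymbol{s}^n, y^n)$, $n = 1, \dots, N$, be independent trajectories of this chain, where the first state is uniform on layer $1$, $\boldsymbol{s}^n = (s^n_1, \dots, s^n_T)$ is the sequence of transient states and $y^n \in \{0,1\}$ is the absorbing state reached. Occurrences below are counted with multiplicity. The direct (DCE) estimator $\hat p^{\mathrm{dir}}_{mk}$ is the fraction of the occurrences of $m$ in the data that lie in trajectories with $y^n = k$. For the indirect (TC) estimator, let $\hat q_{mm'}$ and $\hat r_{mk}$ be the fractions of the observed one-step transitions out of $m$ that go to the transient state $m'$ and to the absorbing state $k$, respectively; then $\hat{\boldsymbol P}^{\mathrm{ind}} = \lim_{i \to \infty} \boldsymbol P_i$,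 where $\boldsymbol P_{i+1} = \hat{\boldsymbol Q} \boldsymbol P_i + \hat{\boldsymbol R}$ and $\boldsymbol P_0$ is an arbitrary fixed row-stochastic matrix. For states that do not occur in the data, the row of $\hat{\boldsymbol P}^{\mathrm{dir}}$ is that of an arbitrary fixed row-stochastic matrix, and the iteration leaves the row of $\boldsymbol P_i$ unchanged. Then, for every state $m$ in the first layer and every $k \in \{0, 1\}$, $$\frac{\mathbf{E}\bigl[(\hat p^{\mathrm{ind}}_{mk} - p^\star_{mk})^2\bigr]}{\mathbf{E}\bigl[(\hat p^{\mathrm{dir}}_{mk} - p^\star_{mk})^2\bigr]} \longrightarrow \frac1W \qquad (N \to \infty).$$ -/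

import Mathlib

open Filter Topology MeasureTheory ProbabilityTheory

/-- Nonnegative entries, every row summing to one. -/
def IsRowStochastic {S K : Type*} [Fintype K] (P : Matrix S K ℝ) : Prop :=
  (∀ m k, 0 ≤ P m k) ∧ ∀ m, ∑ k, P m k = 1

/-- A trajectory through `L` transient states, followed by the class (absorbing state) it ends in. -/
abbrev Trajectory (L : ℕ) (S K : Type*) := (Fin L → S) × K

noncomputable section

/-- Absorption probabilities of the chain with transient-to-transient transition matrix `Q` and
transient-to-absorbing transition matrix `R`: starting in `m`, the chain enters the absorbing state
`k` at step `t + 1` with probability `(Q ^ t * R) m k`. -/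
def absorptionProb {S K : Type*} [Fintype S] [DecidableEq S]
    (Q : Matrix S S ℝ) (R : Matrix S K ℝ) : Matrix S K ℝ :=
  fun m k => ∑' t : ℕ, (Q ^ t * R) m k

/-- Probability that the chain `(Q, R)` with initial distribution `ν` follows exactly the
trajectory `τ`. -/
def trajectoryProb {L : ℕ} [NeZero L] {S K : Type*}
    (ν : S → ℝ) (Q : Matrix S S ℝ) (R : Matrix S K ℝ) (τ : Trajectory L S K) : ℝ :=
  ν (τ.1 0) * ∏ t : Fin L,
    if h : t.val + 1 < L then Q (τ.1 t) (τ.1 ⟨t.val + 1, h⟩) else R (τ.1 t) τ.2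

/-! ### Estimators

A dataset is a family of `N` trajectories. All counts are with multiplicity: they range over the
pairs `(n, t)` of a trajectory and a position in it. -/

section Estimators

variable {N L : ℕ} {S K : Type*} [DecidableEq S] [DecidableEq K]

/-- Number of occurrences of the transient state `m`. -/
def visitCount (D : Fin N → Trajectory L S K) (m : S) : ℕ :=
  (Finset.univ.filter fun p : Fin N × Fin L => (D p.1).1 p.2 = m).card

/-- Number of occurrences of `m` in trajectories that end in class `k`. -/
def outcomeCount (D : Fin N → Trajectory L S K) (m : S) (k : K) : ℕ :=
  (Finset.univ.filter fun p : Fin N × Fin L => (D p.1).1 p.2 = m ∧ (D p.1).2 = k).card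

/-- Number of one-step transitions from `m` to the transient state `m'`. -/
def transitionCount (D : Fin N → Trajectory L S K) (m m' : S) : ℕ :=
  (Finset.univ.filter fun p : Fin N × Fin L =>
    (D p.1).1 p.2 = m ∧ ∃ h : p.2.val + 1 < L, (D p.1).1 ⟨p.2.val + 1, h⟩ = m').card

/-- Number of one-step transitions from `m` to the absorbing state `k`. -/
def absorptionCount (D : Fin N → Trajectory L S K) (m : S) (k : K) : ℕ :=
  (Finset.univ.filter fun p : Fin N × Fin L =>
    (D p.1).1 p.2 = m ∧ p.2.val + 1 = L ∧ (D p.1).2 = k).card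

/-- Direct estimator: the fraction of the occurrences of `m` that end in class `k`. The data say
nothing about a state that does not occur; its row is taken from `P₀`. -/
def directEstimate (P₀ : Matrix S K ℝ) (D : Fin N → Trajectory L S K) : Matrix S K ℝ :=
  fun m k => if visitCount D m = 0 then P₀ m k
    else (outcomeCount D m k : ℝ) / (visitCount D m : ℝ)

/-- Empirical transition probabilities between transient states. The row of a state that does not
occur is the identity row, so that the fixed-point iteration leaves that state's estimate at its
initial value. -/
def empiricalQ (D : Fin N → Trajectory L S K) : Matrix S S ℝ :=
  fun m m' => if visitCount D m = 0 then (if m = m' then 1 else 0)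
    else (transitionCount D m m' : ℝ) / (visitCount D m : ℝ)

/-- Empirical transition probabilities into the absorbing states. -/
def empiricalR (D : Fin N → Trajectory L S K) : Matrix S K ℝ :=
  fun m k => if visitCount D m = 0 then 0
    else (absorptionCount D m k : ℝ) / (visitCount D m : ℝ)

/-- Indirect estimator: the limit of the iteration `P ↦ Q̂ P + R̂` on the empirical chain, started
from `P₀`. -/
def indirectEstimate [Fintype S] (P₀ : Matrix S K ℝ) (D : Fin N → Trajectory L S K) :
    Matrix S K ℝ :=
  fun m k => limUnder atTop fun i : ℕ =>
    ((fun P : Matrix S K ℝ => empiricalQ D * P + empiricalR D)^[i] P₀) m k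

end Estimators

/-! ### The layered chain

The transient state `(t, i)` is the `i`-th state of layer `t`, layers being numbered from `0`. -/

section Layered

variable (T W : ℕ)

/-- The uniform distribution on the first layer. -/
def layeredInit : Fin T × Fin W → ℝ :=
  fun s => if s.1.val = 0 then 1 / (W : ℝ) else 0

/-- Uniform transitions from each layer to the next one. -/
def layeredQ : Matrix (Fin T × Fin W) (Fin T × Fin W) ℝ :=
  fun s s' => if s'.1.val = s.1.val + 1 then 1 / (W : ℝ) else 0

/-- From the last layer, each of the two absorbing states is entered with probability `1/2`. -/
def layeredR : Matrix (Fin T × Fin W) (Fin 2) ℝ :=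
  fun s _ => if s.1.val + 1 = T then 1 / 2 else 0

end Layered

end

/-! Once every state has been visited, the error of either estimator is a sum over the trajectories
of `outcomeSign` (a sign ±1/2) times a weight `w s / visitCount D s`, where `s` is the state
occupied in a fixed layer. For the direct estimator the layer is the first and `w` is the indicator
of `m` (`directEstimate_sub_half`). For the indirect one it is the last and `w` is row `m` of the
`(T - 1)`-th power of the empirical `Q` (`indirectEstimate_sub_half`).

The weights depend on the paths only, and given the paths the signs are independent and fair. Hence
the cross terms vanish (`integral_sum_mul_outcomeSign_sq`) and the mean squared error is 1/4 of the
mean of `∑ s, w s ^ 2 / visitCount D s`, up to an exponentially unlikely event. Visit counts grow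
like `N / W` and `w` converges to some `w'`, so `N` times the error tends to `W / 4 * ∑ s, w' s ^ 2`
(`tendsto_mul_integral_sq_sub_half`). The sum of squares is 1 for the point mass at `m` and `1 / W`
for the uniform distribution on the last layer: the indirect estimator gains by pooling all
trajectories. -/

section Counts

/-! ### Counts as sums over trajectories; bounds on the estimates -/

variable {N L : ℕ} {S K : Type*}

lemma visitCount_eq_sum [DecidableEq S] (D : Fin N → Trajectory L S K) (m : S) :
    (visitCount D m : ℝ) = ∑ n, ∑ u, if (D n).1 u = m then 1 else 0 := by
  rw [visitCount, Finset.card_filter, Fintype.sum_prod_type]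
  push_cast
  rfl

lemma transitionCount_eq_sum [DecidableEq S] (D : Fin N → Trajectory L S K) (m m' : S) :
    (transitionCount D m m' : ℝ) = ∑ n, ∑ u : Fin L,
      if (D n).1 u = m ∧ ∃ h : u.val + 1 < L, (D n).1 ⟨u.val + 1, h⟩ = m' then 1 else 0 := by
  rw [transitionCount, Finset.card_filter, Fintype.sum_prod_type]
  push_cast
  rfl

lemma absorptionCount_eq_sum [DecidableEq S] [DecidableEq K]
    (D : Fin N → Trajectory L S K) (m : S) (k : K) :
    (absorptionCount D m k : ℝ) = ∑ n, ∑ u : Fin L,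
      if (D n).1 u = m ∧ u.val + 1 = L ∧ (D n).2 = k then 1 else 0 := by
  rw [absorptionCount, Finset.card_filter, Fintype.sum_prod_type]
  push_cast
  rfl

lemma outcomeCount_eq_sum [DecidableEq S] [DecidableEq K]
    (D : Fin N → Trajectory L S K) (m : S) (k : K) :
    (outcomeCount D m k : ℝ) = ∑ n, ∑ u : Fin L,
      if (D n).1 u = m ∧ (D n).2 = k then 1 else 0 := by
  rw [outcomeCount, Finset.card_filter, Fintype.sum_prod_type]
  push_cast
  rfl

lemma outcomeCount_le_visitCount [DecidableEq S] [DecidableEq K]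
    (D : Fin N → Trajectory L S K) (m : S) (k : K) :
    outcomeCount D m k ≤ visitCount D m :=
  Finset.card_le_card (Finset.monotone_filter_right _ fun _ _ h => h.1)

/-- Every occurrence of `m` is followed by at most one of the transitions out of `m`. -/
lemma sum_transitionCount_add_absorptionCount_le [DecidableEq S] [DecidableEq K] [Fintype S]
    (D : Fin N → Trajectory L S K)
    (m : S) (k : K) :
    ∑ m', (transitionCount D m m' : ℝ) + absorptionCount D m k ≤ visitCount D m := by
  simp only [transitionCount_eq_sum, absorptionCount_eq_sum, visitCount_eq_sum]
  rw [Finset.sum_comm, ← Finset.sum_add_distrib]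
  refine Finset.sum_le_sum fun n _ => ?_
  rw [Finset.sum_comm, ← Finset.sum_add_distrib]
  refine Finset.sum_le_sum fun u _ => ?_
  by_cases h : u.val + 1 < L
  · have h' : u.val + 1 ≠ L := h.ne
    by_cases hm : (D n).1 u = m <;> simp [h, h', hm]
  · by_cases hm : (D n).1 u = m <;> simp [h, hm]
    split_ifs <;> norm_num

lemma empiricalQ_nonneg [DecidableEq S] (D : Fin N → Trajectory L S K) (m m' : S) :
    0 ≤ empiricalQ D m m' := by
  unfold empiricalQ
  split_ifs <;> positivity

lemma empiricalR_nonneg [DecidableEq S] [DecidableEq K]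
    (D : Fin N → Trajectory L S K) (m : S) (k : K) :
    0 ≤ empiricalR D m k := by
  unfold empiricalR
  split_ifs <;> positivity

lemma sum_empiricalQ_add_empiricalR_le_one [DecidableEq S] [DecidableEq K] [Fintype S]
    (D : Fin N → Trajectory L S K) (m : S)
    (k : K) : ∑ m', empiricalQ D m m' + empiricalR D m k ≤ 1 := by
  unfold empiricalQ empiricalR
  by_cases h : visitCount D m = 0
  · simp [h]
  · have hpos : (0 : ℝ) < visitCount D m := by exact_mod_cast Nat.pos_of_ne_zero h
    simp only [h, if_false]
    rw [← Finset.sum_div, ← add_div, div_le_one hpos]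
    exact sum_transitionCount_add_absorptionCount_le D m k

lemma sum_empiricalQ_le_one [DecidableEq S] [DecidableEq K] [Fintype S]
    (D : Fin N → Trajectory L S K) (k : K) (m : S) :
    ∑ m', empiricalQ D m m' ≤ 1 := by
  linarith [sum_empiricalQ_add_empiricalR_le_one D m k, empiricalR_nonneg D m k]

/-- The map whose iterates define the indirect estimator. -/
noncomputable def empiricalStep [DecidableEq S] [DecidableEq K] [Fintype S]
    (D : Fin N → Trajectory L S K) (P : Matrix S K ℝ) :
    Matrix S K ℝ :=
  empiricalQ D * P + empiricalR D

lemma empiricalStep_apply [DecidableEq S] [DecidableEq K] [Fintype S]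
    (D : Fin N → Trajectory L S K) (P : Matrix S K ℝ)
    (m : S) (k : K) :
    empiricalStep D P m k = ∑ m', empiricalQ D m m' * P m' k + empiricalR D m k := by
  simp [empiricalStep, Matrix.add_apply, Matrix.mul_apply]

/-- Each step is a subconvex combination of earlier values. The bound controls the error when some
state is rare. -/
lemma empiricalStep_iterate_mem_Icc [DecidableEq S] [DecidableEq K] [Fintype S]
    (D : Fin N → Trajectory L S K)
    {P : Matrix S K ℝ} {k : K} (hP : ∀ m, P m k ∈ Set.Icc (0 : ℝ) 1) (i : ℕ) (m : S) :
    ((empiricalStep D)^[i] P) m k ∈ Set.Icc (0 : ℝ) 1 := by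
  induction i generalizing m with
  | zero => exact hP m
  | succ i ih =>
    rw [Function.iterate_succ_apply', empiricalStep_apply]
    constructor
    · have := empiricalR_nonneg D m k
      have : 0 ≤ ∑ m', empiricalQ D m m' * ((empiricalStep D)^[i] P) m' k :=
        Finset.sum_nonneg fun m' _ => mul_nonneg (empiricalQ_nonneg D m m') (ih m').1
      linarith
    · have : ∑ m', empiricalQ D m m' * ((empiricalStep D)^[i] P) m' k ≤ ∑ m', empiricalQ D m m' :=
        Finset.sum_le_sum fun m' _ =>
          mul_le_of_le_one_right (empiricalQ_nonneg D m m') (ih m').2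
      linarith [sum_empiricalQ_add_empiricalR_le_one D m k]

lemma IsRowStochastic.mem_Icc [Fintype K] {P : Matrix S K ℝ} (hP : IsRowStochastic P) (m : S)
    (k : K) : P m k ∈ Set.Icc (0 : ℝ) 1 :=
  ⟨hP.1 m k, hP.2 m ▸ Finset.single_le_sum (fun k _ => hP.1 m k) (Finset.mem_univ k)⟩

lemma directEstimate_mem_Icc [DecidableEq S] [DecidableEq K] [Fintype K]
    {P : Matrix S K ℝ} (hP : IsRowStochastic P)
    (D : Fin N → Trajectory L S K) (m : S) (k : K) :
    directEstimate P D m k ∈ Set.Icc (0 : ℝ) 1 := by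
  unfold directEstimate
  split_ifs
  · exact hP.mem_Icc m k
  · exact ⟨by positivity, div_le_one_of_le₀ (by exact_mod_cast outcomeCount_le_visitCount D m k)
      (by positivity)⟩

end Counts

/-! ### Powers of substochastic and of layered matrices -/

section Powers

variable {S : Type*} [Fintype S] [DecidableEq S]

lemma pow_nonneg_of_entries_nonneg {Q : Matrix S S ℝ} (hQ : ∀ s s', 0 ≤ Q s s') (j : ℕ)
    (s s' : S) : 0 ≤ (Q ^ j) s s' := by
  induction j generalizing s' with
  | zero => rw [pow_zero, Matrix.one_apply]; split_ifs <;> norm_num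
  | succ j ih =>
    rw [pow_succ, Matrix.mul_apply]
    exact Finset.sum_nonneg fun x _ => mul_nonneg (ih x) (hQ x s')

lemma sum_pow_le_one {Q : Matrix S S ℝ} (hQ : ∀ s s', 0 ≤ Q s s') (hsum : ∀ s, ∑ s', Q s s' ≤ 1)
    (j : ℕ) (s : S) : ∑ s', (Q ^ j) s s' ≤ 1 := by
  induction j with
  | zero => simp [Matrix.one_apply]
  | succ j ih =>
    simp only [pow_succ, Matrix.mul_apply]
    rw [Finset.sum_comm]
    simp only [← Finset.mul_sum]
    exact (Finset.sum_le_sum fun x _ =>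
      mul_le_of_le_one_right (pow_nonneg_of_entries_nonneg hQ j s x) (hsum x)).trans ih

lemma pow_entry_le_one {Q : Matrix S S ℝ} (hQ : ∀ s s', 0 ≤ Q s s')
    (hsum : ∀ s, ∑ s', Q s s' ≤ 1) (j : ℕ) (s s' : S) : (Q ^ j) s s' ≤ 1 :=
  (Finset.single_le_sum (fun x _ => pow_nonneg_of_entries_nonneg hQ j s x)
    (Finset.mem_univ s')).trans (sum_pow_le_one hQ hsum j s)

/-- A matrix which moves one layer up is supported, in its `j`-th power, `j` layers up. -/
lemma pow_eq_zero_of_layer_ne {ℓ : S → ℕ} {Q : Matrix S S ℝ}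
    (hQ : ∀ s s', ℓ s' ≠ ℓ s + 1 → Q s s' = 0) (j : ℕ) {s s' : S} (h : ℓ s' ≠ ℓ s + j) :
    (Q ^ j) s s' = 0 := by
  induction j generalizing s' with
  | zero =>
    rw [pow_zero, Matrix.one_apply_ne]
    rintro rfl
    exact h rfl
  | succ j ih =>
    rw [pow_succ, Matrix.mul_apply]
    refine Finset.sum_eq_zero fun x _ => ?_
    by_cases hx : ℓ x = ℓ s + j
    · rw [hQ x s' (by omega), mul_zero]
    · rw [ih hx, zero_mul]

/-- A function which is harmonic below layer `j` is averaged by the `j`-th power. -/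
lemma eq_sum_pow_mul_of_harmonic {ℓ : S → ℕ} {Q : Matrix S S ℝ}
    (hQ : ∀ s s', ℓ s' ≠ ℓ s + 1 → Q s s' = 0) {U : S → ℝ} (j : ℕ) {s : S}
    (hU : ∀ x, ℓ x < ℓ s + j → U x = ∑ y, Q x y * U y) :
    U s = ∑ x, (Q ^ j) s x * U x := by
  induction j with
  | zero => simp [Matrix.one_apply]
  | succ j ih =>
    rw [ih fun x hx => hU x (by omega)]
    simp only [pow_succ, Matrix.mul_apply, Finset.sum_mul]
    rw [Finset.sum_comm]
    refine Finset.sum_congr rfl fun x _ => ?_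
    by_cases hx : ℓ x = ℓ s + j
    · rw [hU x (by omega), Finset.mul_sum]
      simp only [mul_assoc]
    · simp [pow_eq_zero_of_layer_ne hQ j hx]

end Powers

/-! ### The estimators on layered data, without probability -/

section Layered

variable {N T W : ℕ}

/-- The trajectory visits the layers in order, one at each step. -/
def IsLayered (τ : Trajectory T (Fin T × Fin W) (Fin 2)) : Prop :=
  ∀ t, (τ.1 t).1 = t

/-- Only position `s.1` of a layered trajectory can be in `s`, so sums over positions collapse to
one term. -/
lemma IsLayered.sum_visit {τ : Trajectory T (Fin T × Fin W) (Fin 2)} (hτ : IsLayered τ)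
    (s : Fin T × Fin W) (p : Fin T → Prop) [DecidablePred p] :
    (∑ u, if τ.1 u = s ∧ p u then (1 : ℝ) else 0) = if τ.1 s.1 = s ∧ p s.1 then 1 else 0 := by
  refine Finset.sum_eq_single s.1 (fun u _ hu => if_neg ?_) (by simp)
  rintro ⟨h, -⟩
  exact hu (by rw [← h, hτ u])

variable {D : Fin N → Trajectory T (Fin T × Fin W) (Fin 2)}

lemma visitCount_of_isLayered (hD : ∀ n, IsLayered (D n)) (s : Fin T × Fin W) :
    (visitCount D s : ℝ) = ∑ n, if (D n).1 s.1 = s then 1 else 0 := by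
  rw [visitCount_eq_sum]
  refine Finset.sum_congr rfl fun n _ => ?_
  simpa using (hD n).sum_visit s fun _ => True

lemma outcomeCount_of_isLayered (hD : ∀ n, IsLayered (D n)) (s : Fin T × Fin W) (k : Fin 2) :
    (outcomeCount D s k : ℝ) = ∑ n, if (D n).1 s.1 = s ∧ (D n).2 = k then 1 else 0 := by
  rw [outcomeCount_eq_sum]
  exact Finset.sum_congr rfl fun n _ => (hD n).sum_visit s fun _ => (D n).2 = k

lemma absorptionCount_of_isLayered (hD : ∀ n, IsLayered (D n)) (s : Fin T × Fin W) (k : Fin 2) :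
    (absorptionCount D s k : ℝ) =
      ∑ n, if (D n).1 s.1 = s ∧ s.1.val + 1 = T ∧ (D n).2 = k then 1 else 0 := by
  rw [absorptionCount_eq_sum]
  exact Finset.sum_congr rfl fun n _ =>
    (hD n).sum_visit s fun u => u.val + 1 = T ∧ (D n).2 = k

lemma transitionCount_of_isLayered (hD : ∀ n, IsLayered (D n)) (s s' : Fin T × Fin W) :
    (transitionCount D s s' : ℝ) = ∑ n, if (D n).1 s.1 = s ∧
      ∃ h : s.1.val + 1 < T, (D n).1 ⟨s.1.val + 1, h⟩ = s' then 1 else 0 := by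
  rw [transitionCount_eq_sum]
  exact Finset.sum_congr rfl fun n _ =>
    (hD n).sum_visit s fun u => ∃ h : u.val + 1 < T, (D n).1 ⟨u.val + 1, h⟩ = s'

lemma transitionCount_eq_zero_of_isLayered (hD : ∀ n, IsLayered (D n)) {s s' : Fin T × Fin W}
    (h : s'.1.val ≠ s.1.val + 1) : (transitionCount D s s' : ℝ) = 0 := by
  rw [transitionCount_of_isLayered hD]
  refine Finset.sum_eq_zero fun n _ => if_neg ?_
  rintro ⟨-, h', rfl⟩
  exact h (by rw [hD n])

lemma sum_transitionCount_of_isLayered (hD : ∀ n, IsLayered (D n)) {s : Fin T × Fin W}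
    (h : s.1.val + 1 < T) : ∑ s', (transitionCount D s s' : ℝ) = visitCount D s := by
  simp only [transitionCount_of_isLayered hD, visitCount_of_isLayered hD]
  rw [Finset.sum_comm]
  refine Finset.sum_congr rfl fun n _ => ?_
  by_cases hs : (D n).1 s.1 = s <;> simp [hs, h]

lemma empiricalQ_of_visited {s : Fin T × Fin W} (hs : visitCount D s ≠ 0) (s' : Fin T × Fin W) :
    empiricalQ D s s' = transitionCount D s s' / visitCount D s := by
  simp [empiricalQ, hs]

lemma empiricalQ_eq_zero_of_layer_ne (hD : ∀ n, IsLayered (D n)) {s : Fin T × Fin W}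
    (hs : visitCount D s ≠ 0) (s' : Fin T × Fin W) (h : s'.1.val ≠ s.1.val + 1) :
    empiricalQ D s s' = 0 := by
  rw [empiricalQ_of_visited hs, transitionCount_eq_zero_of_isLayered hD h, zero_div]

/-- On layered data the iteration at a state of layer `t` is stationary from step `T - t` on. -/
lemma empiricalStep_iterate_succ_eq (hD : ∀ n, IsLayered (D n))
    (P : Matrix (Fin T × Fin W) (Fin 2) ℝ) (k : Fin 2) (i : ℕ) (s : Fin T × Fin W)
    (h : T ≤ i + s.1.val) :
    ((empiricalStep D)^[i + 1] P) s k = ((empiricalStep D)^[i] P) s k := by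
  induction i generalizing s with
  | zero => have := s.1.isLt; omega
  | succ i ih =>
    by_cases hs : visitCount D s = 0
    -- An unvisited state has the identity row, so its value never moves.
    · rw [Function.iterate_succ_apply', empiricalStep_apply]
      simp [empiricalQ, empiricalR, hs]
    · rw [Function.iterate_succ_apply' _ (i + 1), Function.iterate_succ_apply' _ i,
        empiricalStep_apply, empiricalStep_apply]
      congr 1
      refine Finset.sum_congr rfl fun s' _ => ?_
      by_cases hs' : s'.1.val = s.1.val + 1
      · rw [← Function.iterate_succ_apply' (empiricalStep D) i, ih s' (by omega)]
      · rw [empiricalQ_eq_zero_of_layer_ne hD hs s' hs', zero_mul, zero_mul]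

lemma indirectEstimate_of_isLayered (hD : ∀ n, IsLayered (D n))
    (P : Matrix (Fin T × Fin W) (Fin 2) ℝ) :
    indirectEstimate P D = (empiricalStep D)^[T] P := by
  funext s k
  refine Tendsto.limUnder_eq (tendsto_atTop_of_eventually_const (i₀ := T) fun i hi => ?_)
  change ((empiricalStep D)^[i] P) s k = _
  induction i, hi using Nat.le_induction with
  | base => rfl
  | succ i hi ih => rw [empiricalStep_iterate_succ_eq hD P k i s (by omega), ih]

lemma indirectEstimate_mem_Icc (hD : ∀ n, IsLayered (D n))
    {P : Matrix (Fin T × Fin W) (Fin 2) ℝ} (hP : IsRowStochastic P) (s : Fin T × Fin W)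
    (k : Fin 2) : indirectEstimate P D s k ∈ Set.Icc (0 : ℝ) 1 := by
  rw [indirectEstimate_of_isLayered hD]
  exact empiricalStep_iterate_mem_Icc D (fun m => hP.mem_Icc m k) T s

/-- The iteration has stopped moving after `T` steps, so the estimate is an exact fixed point, also
in the rows of unvisited states. -/
lemma indirectEstimate_eq_add (hD : ∀ n, IsLayered (D n))
    (P : Matrix (Fin T × Fin W) (Fin 2) ℝ) (s : Fin T × Fin W) (k : Fin 2) :
    indirectEstimate P D s k =
      ∑ s', empiricalQ D s s' * indirectEstimate P D s' k + empiricalR D s k := by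
  rw [indirectEstimate_of_isLayered hD, ← empiricalStep_apply,
    ← Function.iterate_succ_apply' (empiricalStep D) T,
    empiricalStep_iterate_succ_eq hD P k T s (by omega)]

/-- The centred indicator of the trajectory ending in class `k`. -/
noncomputable def outcomeSign (k : Fin 2) (τ : Trajectory T (Fin T × Fin W) (Fin 2)) : ℝ :=
  (if τ.2 = k then 1 else 0) - 1 / 2

lemma outcomeCount_div_sub_half (hD : ∀ n, IsLayered (D n)) {s : Fin T × Fin W}
    (hs : visitCount D s ≠ 0) (k : Fin 2) :
    (outcomeCount D s k : ℝ) / visitCount D s - 1 / 2 =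
      (∑ n, if (D n).1 s.1 = s then outcomeSign k (D n) else 0) / visitCount D s := by
  have hs' : (visitCount D s : ℝ) ≠ 0 := by exact_mod_cast hs
  have : (∑ n, if (D n).1 s.1 = s then outcomeSign k (D n) else 0) =
      (outcomeCount D s k : ℝ) - 1 / 2 * visitCount D s := by
    rw [outcomeCount_of_isLayered hD, visitCount_of_isLayered hD, Finset.mul_sum,
      ← Finset.sum_sub_distrib]
    refine Finset.sum_congr rfl fun n _ => ?_
    unfold outcomeSign
    by_cases h : (D n).1 s.1 = s <;> simp [h]
  rw [this]
  field_simp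

/-- The weighted average of the outcomes in which a trajectory that is in state `s` of
layer `u` has weight `w s` divided by the number of visits to `s`. -/
noncomputable def weightedOutcome (k : Fin 2) (u : Fin T) (w : Fin T × Fin W → ℝ)
    (D : Fin N → Trajectory T (Fin T × Fin W) (Fin 2)) : ℝ :=
  ∑ n, w ((D n).1 u) / visitCount D ((D n).1 u) * outcomeSign k (D n)

/-- The trajectories are grouped by their state in layer `u`; `hw` discards the states of other
layers. -/
lemma weightedOutcome_eq_sum (hD : ∀ n, IsLayered (D n)) (k : Fin 2) {u : Fin T}
    {w : Fin T × Fin W → ℝ} (hw : ∀ s, s.1 ≠ u → w s = 0) :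
    weightedOutcome k u w D = ∑ s : Fin T × Fin W,
      w s * ((∑ n, if (D n).1 s.1 = s then outcomeSign k (D n) else 0) / visitCount D s) := by
  simp only [Finset.sum_div, Finset.mul_sum]
  rw [Finset.sum_comm, weightedOutcome]
  refine Finset.sum_congr rfl fun n _ => ?_
  rw [Finset.sum_eq_single ((D n).1 u)]
  · rw [hD n u, if_pos rfl]
    ring
  · intro s _ hs
    by_cases h : s.1 = u
    · rw [if_neg (by rw [h]; exact hs.symm), zero_div, mul_zero]
    · rw [hw s h, zero_mul]
  · simp

/-- Each `s` in layer `u` receives `visitCount D s` equal terms, which cancels one factor of the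
squared denominator. At an unvisited state both sides are zero. -/
lemma sum_weight_sq (hD : ∀ n, IsLayered (D n)) {u : Fin T} {w : Fin T × Fin W → ℝ}
    (hw : ∀ s, s.1 ≠ u → w s = 0) :
    ∑ n, (w ((D n).1 u) / visitCount D ((D n).1 u)) ^ 2 = ∑ s, w s ^ 2 / visitCount D s := by
  have key : ∀ s : Fin T × Fin W, w s ^ 2 / visitCount D s =
      ∑ n, if (D n).1 u = s then (w s / visitCount D s) ^ 2 else 0 := by
    intro s
    by_cases h : s.1 = u
    · have : (∑ n, if (D n).1 u = s then (w s / visitCount D s) ^ 2 else 0) =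
          (visitCount D s : ℝ) * (w s / visitCount D s) ^ 2 := by
        generalize (w s / visitCount D s) ^ 2 = c
        rw [visitCount_of_isLayered hD, Finset.sum_mul, h]
        simp
      rw [this]
      by_cases hs : (visitCount D s : ℝ) = 0
      · simp [hs]
      · field_simp
    · simp [hw s h]
  simp only [key]
  rw [Finset.sum_comm]
  simp

lemma directEstimate_sub_half (hD : ∀ n, IsLayered (D n)) {s : Fin T × Fin W}
    (hs : visitCount D s ≠ 0) (P : Matrix (Fin T × Fin W) (Fin 2) ℝ) (k : Fin 2) :
    directEstimate P D s k - 1 / 2 =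
      weightedOutcome k s.1 (fun x => if x = s then 1 else 0) D := by
  rw [weightedOutcome_eq_sum hD k (by rintro x hx; rw [if_neg]; rintro rfl; exact hx rfl)]
  simp [directEstimate, hs, ← outcomeCount_div_sub_half hD hs k]

/-- Below the last layer the empirical rows sum to one, so the deviation from 1/2 is harmonic and is
averaged by powers of `empiricalQ`. In the last layer every visit is followed by absorption, so the
estimate there is the plain outcome fraction. -/
lemma indirectEstimate_sub_half (hD : ∀ n, IsLayered (D n)) (hs : ∀ s, visitCount D s ≠ 0)
    (P : Matrix (Fin T × Fin W) (Fin 2) ℝ) (k : Fin 2) {s : Fin T × Fin W} {u : Fin T} {j : ℕ}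
    (hu : u.val + 1 = T) (hj : s.1.val + j = u.val) :
    indirectEstimate P D s k - 1 / 2 = weightedOutcome k u ((empiricalQ D ^ j) s) D := by
  have hQ : ∀ s s' : Fin T × Fin W, s'.1.val ≠ s.1.val + 1 → empiricalQ D s s' = 0 :=
    fun s s' h => empiricalQ_eq_zero_of_layer_ne hD (hs s) s' h
  have hsupp : ∀ s', s'.1 ≠ u → (empiricalQ D ^ j) s s' = 0 := fun s' h =>
    pow_eq_zero_of_layer_ne (ℓ := fun s => s.1.val) hQ j
      (by rw [hj]; exact fun h' => h (Fin.ext h'))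
  rw [weightedOutcome_eq_sum hD k hsupp]
  have hpos : ∀ s, (visitCount D s : ℝ) ≠ 0 := fun s => by exact_mod_cast hs s
  rw [eq_sum_pow_mul_of_harmonic (ℓ := fun s => s.1.val) hQ
    (U := fun s => indirectEstimate P D s k - 1 / 2) j (s := s)]
  · refine Finset.sum_congr rfl fun x _ => ?_
    by_cases hx : x.1 = u
    · rw [← outcomeCount_div_sub_half hD (hs x), indirectEstimate_eq_add hD,
        Finset.sum_eq_zero, zero_add]
      · have : (absorptionCount D x k : ℝ) = outcomeCount D x k := by
          rw [absorptionCount_of_isLayered hD, outcomeCount_of_isLayered hD, hx]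
          simp [hu]
        simp [empiricalR, hs, this]
      · intro y _
        rw [hQ x y (by have := y.1.isLt; rw [hx]; omega), zero_mul]
    · rw [hsupp x hx, zero_mul, zero_mul]
  · intro x hx
    have hxT : x.1.val + 1 < T := by omega
    have h1 : ∑ y, empiricalQ D x y = 1 := by
      simp only [empiricalQ_of_visited (hs x)]
      rw [← Finset.sum_div, sum_transitionCount_of_isLayered hD hxT, div_self (hpos x)]
    have h2 : empiricalR D x k = 0 := by
      simp [empiricalR, absorptionCount_of_isLayered hD, hxT.ne]
    simp only [mul_sub, Finset.sum_sub_distrib, ← Finset.sum_mul, h1]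
    rw [indirectEstimate_eq_add hD, h2, add_zero, one_mul]

end Layered

/-! ### The true chain: powers, absorption, trajectory probabilities -/

section LayeredChain

variable {T W : ℕ}

/-- One step makes the chain uniform on its layer, and each further step sums `W` terms `1 / W ^ 2`.
-/
lemma layeredQ_pow_succ (j : ℕ) (s s' : Fin T × Fin W) :
    (layeredQ T W ^ (j + 1)) s s' = if s'.1.val = s.1.val + (j + 1) then 1 / (W : ℝ) else 0 := by
  have hW : (W : ℝ) ≠ 0 := by have := s.2.pos; positivity
  induction j generalizing s with
  | zero => simp [layeredQ]
  | succ j ih =>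
    rw [pow_succ', Matrix.mul_apply]
    simp only [ih, layeredQ]
    rw [Fintype.sum_prod_type]
    change (∑ t : Fin T, ∑ _i : Fin W, (if t.val = s.1.val + 1 then 1 / (W : ℝ) else 0) *
      (if s'.1.val = t.val + (j + 1) then 1 / (W : ℝ) else 0)) = _
    simp only [Finset.sum_const, Finset.card_univ, Fintype.card_fin, nsmul_eq_mul]
    by_cases h : s'.1.val = s.1.val + (j + 1 + 1)
    · rw [if_pos h, Finset.sum_eq_single ⟨s.1.val + 1, by have := s'.1.isLt; omega⟩]
      · rw [if_pos rfl, if_pos (by simp only; omega)]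
        field_simp
      · intro t _ ht
        rw [if_neg fun h' : t.val = s.1.val + 1 => ht (Fin.ext h')]
        simp
      · simp
    · rw [if_neg h]
      refine Finset.sum_eq_zero fun t _ => ?_
      by_cases ht : t.val = s.1.val + 1
      · rw [if_neg (by omega : ¬ s'.1.val = t.val + (j + 1))]
        simp
      · simp [ht]

lemma layeredQ_eq_zero (s s' : Fin T × Fin W) (h : s'.1.val ≠ s.1.val + 1) :
    layeredQ T W s s' = 0 := if_neg h

lemma sum_layeredQ_pow [NeZero T] (m : Fin W) {j : ℕ} (hj : j < T) :
    ∑ s, (layeredQ T W ^ j) (0, m) s = 1 := by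
  have hW : (W : ℝ) ≠ 0 := by have := m.pos; positivity
  cases j with
  | zero => simp [Matrix.one_apply]
  | succ j =>
    simp only [layeredQ_pow_succ]
    rw [Fintype.sum_prod_type, Finset.sum_eq_single ⟨j + 1, hj⟩]
    · simp [hW]
    · intro t _ ht
      refine Finset.sum_eq_zero fun i _ => if_neg ?_
      rintro h
      exact ht (Fin.ext (by simpa using h))
    · simp

lemma sum_layeredQ_pow_sq [NeZero T] (hTW : T = 1 → W = 1) (m : Fin W) :
    ∑ s, (layeredQ T W ^ (T - 1)) (0, m) s ^ 2 = 1 / (W : ℝ) := by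
  have hW : (W : ℝ) ≠ 0 := by have := m.pos; positivity
  have key : ∀ s, (layeredQ T W ^ (T - 1)) (0, m) s ^ 2 =
      (layeredQ T W ^ (T - 1)) (0, m) s * (1 / (W : ℝ)) := by
    intro s
    obtain hT | ⟨j, hj⟩ : T = 1 ∨ ∃ j, T - 1 = j + 1 := by
      have := NeZero.pos T
      by_cases h : T = 1
      · exact .inl h
      · exact .inr ⟨T - 2, by omega⟩
    -- With a single layer the row is a point mass, whose sum of squares is 1; this is where `W = 1`
    -- is needed.
    · rw [show T - 1 = 0 by omega, show (W : ℝ) = 1 by exact_mod_cast hTW hT, pow_zero,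
        Matrix.one_apply]
      split_ifs <;> simp
    · rw [hj, layeredQ_pow_succ]
      split_ifs <;> ring
  simp only [key]
  rw [← Finset.sum_mul, sum_layeredQ_pow m (Nat.sub_lt (NeZero.pos T) one_pos), one_mul]

/-- Only the term `T - 1` of the series is nonzero, since absorption is possible from the last layer
alone. -/
lemma absorptionProb_layered [NeZero T] (m : Fin W) (k : Fin 2) :
    absorptionProb (layeredQ T W) (layeredR T W) (0, m) k = 1 / 2 := by
  have hT := NeZero.pos T
  unfold absorptionProb
  rw [tsum_eq_single (T - 1)]
  · rw [Matrix.mul_apply]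
    trans (∑ s, (layeredQ T W ^ (T - 1)) (0, m) s) * (1 / 2)
    swap
    · rw [sum_layeredQ_pow m (Nat.sub_lt hT one_pos), one_mul]
    rw [Finset.sum_mul]
    refine Finset.sum_congr rfl fun s _ => ?_
    by_cases h : s.1.val + 1 = T
    · simp [layeredR, h]
    · rw [pow_eq_zero_of_layer_ne (ℓ := fun s => s.1.val) layeredQ_eq_zero, zero_mul, zero_mul]
      simp only [Fin.val_zero]
      omega
  · intro j hj
    rw [Matrix.mul_apply]
    refine Finset.sum_eq_zero fun s _ => ?_
    by_cases h : s.1.val + 1 = T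
    · rw [pow_eq_zero_of_layer_ne (ℓ := fun s => s.1.val) layeredQ_eq_zero, zero_mul]
      simp only [Fin.val_zero]
      omega
    · simp [layeredR, h]

/-- Probability of a trajectory of the layered chain. -/
noncomputable abbrev layeredProb [NeZero T] (τ : Trajectory T (Fin T × Fin W) (Fin 2)) : ℝ :=
  trajectoryProb (layeredInit T W) (layeredQ T W) (layeredR T W) τ

lemma isLayered_of_layeredProb_ne_zero [NeZero T] {τ : Trajectory T (Fin T × Fin W) (Fin 2)}
    (h : layeredProb τ ≠ 0) : IsLayered τ := by
  have h1 := left_ne_zero_of_mul h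
  have h2 := Finset.prod_ne_zero_iff.mp (right_ne_zero_of_mul h)
  have key : ∀ n (hn : n < T), (τ.1 ⟨n, hn⟩).1.val = n := by
    intro n
    induction n with
    | zero =>
      intro hn
      by_contra h0
      exact h1 (if_neg h0)
    | succ n ih =>
      intro hn
      have h3 := h2 ⟨n, by omega⟩ (Finset.mem_univ _)
      rw [dif_pos hn] at h3
      by_contra h0
      exact h3 (if_neg (by rw [ih (by omega)]; exact h0))
  exact fun t => Fin.ext (key t.val t.isLt)

lemma layeredProb_of_isLayered [NeZero T] {τ : Trajectory T (Fin T × Fin W) (Fin 2)}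
    (h : IsLayered τ) : layeredProb τ = (1 / (W : ℝ)) ^ T * (1 / 2) := by
  obtain ⟨n, rfl⟩ := Nat.exists_eq_succ_of_ne_zero (NeZero.ne T)
  have hinit : layeredInit (n + 1) W (τ.1 0) = 1 / W := if_pos (by rw [h 0]; rfl)
  have hstep : ∀ t : Fin n, (if h : t.castSucc.val + 1 < n + 1 then
      layeredQ (n + 1) W (τ.1 t.castSucc) (τ.1 ⟨t.castSucc.val + 1, h⟩)
      else layeredR (n + 1) W (τ.1 t.castSucc) τ.2) = 1 / (W : ℝ) := by
    intro t
    rw [dif_pos (by simp)]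
    exact if_pos (by rw [h, h])
  have hlast : (if h : (Fin.last n).val + 1 < n + 1 then
      layeredQ (n + 1) W (τ.1 (Fin.last n)) (τ.1 ⟨(Fin.last n).val + 1, h⟩)
      else layeredR (n + 1) W (τ.1 (Fin.last n)) τ.2) = 1 / 2 := by
    rw [dif_neg (by simp)]
    exact if_pos (by rw [h]; rfl)
  unfold layeredProb trajectoryProb
  rw [Fin.prod_univ_castSucc, hinit, hlast, Finset.prod_congr rfl fun t _ => hstep t]
  simp only [Finset.prod_const, Finset.card_univ, Fintype.card_fin]
  rw [← mul_assoc, ← pow_succ']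

/-- The layered trajectory with given positions in the layers and given class. -/
def layeredTrajectory (f : (Fin T → Fin W) × Fin 2) : Trajectory T (Fin T × Fin W) (Fin 2) :=
  (fun t => (t, f.1 t), f.2)

lemma isLayered_layeredTrajectory (f : (Fin T → Fin W) × Fin 2) :
    IsLayered (layeredTrajectory f) := fun _ => rfl

/-- Non-layered trajectories have probability zero and layered ones are equally likely, so positions
and class are jointly uniform. -/
lemma sum_layeredProb_mul [NeZero T] (φ : Trajectory T (Fin T × Fin W) (Fin 2) → ℝ) :
    ∑ τ, layeredProb τ * φ τ =
      ∑ f : Fin T → Fin W, ∑ y, (1 / (W : ℝ)) ^ T * (1 / 2) * φ (layeredTrajectory (f, y)) := by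
  rw [← Fintype.sum_prod_type']
  symm
  refine Fintype.sum_of_injective layeredTrajectory ?_ _ _ ?_ ?_
  · rintro ⟨f, y⟩ ⟨f', y'⟩ h
    simp only [layeredTrajectory, Prod.mk.injEq] at h
    refine Prod.ext (funext fun t => ?_) h.2
    simpa using congrFun h.1 t
  · intro τ hτ
    by_contra h
    have hl := isLayered_of_layeredProb_ne_zero (left_ne_zero_of_mul h)
    exact hτ ⟨(fun t => (τ.1 t).2, τ.2), Prod.ext (funext fun t => Prod.ext (hl t).symm rfl) rfl⟩
  · intro f
    rw [layeredProb_of_isLayered (isLayered_layeredTrajectory f)]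

/-- Positions in different layers are independent: the summand is a product over coordinates, each
outside `A` summing to 1. -/
lemma sum_uniform_indicator {W : ℕ} (hW : (W : ℝ) ≠ 0) (A : Finset (Fin T)) (g : Fin T → Fin W) :
    ∑ f : Fin T → Fin W, (1 / (W : ℝ)) ^ T * (if ∀ u ∈ A, f u = g u then 1 else 0) =
      (1 / (W : ℝ)) ^ A.card := by
  have h1 : ∀ f : Fin T → Fin W, (1 / (W : ℝ)) ^ T * (if ∀ u ∈ A, f u = g u then 1 else 0) =
      ∏ u, if u ∈ A → f u = g u then 1 / (W : ℝ) else 0 := by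
    intro f
    rw [Fintype.prod_ite_zero]
    simp
  simp only [h1]
  rw [← Fintype.prod_sum (fun u x => if u ∈ A → x = g u then 1 / (W : ℝ) else 0)]
  have h2 : ∀ u, (∑ x, if u ∈ A → x = g u then 1 / (W : ℝ) else 0) =
      if u ∈ A then 1 / (W : ℝ) else 1 := by
    intro u
    by_cases hu : u ∈ A <;> simp [hu, hW]
  simp only [h2]
  rw [Finset.prod_ite_mem, Finset.univ_inter, Finset.prod_const]

/-- Number of visits of a single trajectory to `s`. -/
noncomputable def visits (s : Fin T × Fin W) (τ : Trajectory T (Fin T × Fin W) (Fin 2)) : ℝ :=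
  ∑ u, if τ.1 u = s then 1 else 0

/-- Number of transitions of a single trajectory from `s` to `s'`. -/
noncomputable def transitions (s s' : Fin T × Fin W)
    (τ : Trajectory T (Fin T × Fin W) (Fin 2)) : ℝ :=
  ∑ u : Fin T, if τ.1 u = s ∧ ∃ h : u.val + 1 < T, τ.1 ⟨u.val + 1, h⟩ = s' then 1 else 0

lemma IsLayered.visits_eq {τ : Trajectory T (Fin T × Fin W) (Fin 2)} (hτ : IsLayered τ)
    (s : Fin T × Fin W) : visits s τ = if τ.1 s.1 = s then 1 else 0 := by
  simpa [visits] using hτ.sum_visit s fun _ => True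

end LayeredChain

/-! ### Expectations of visits and transitions; strong law -/

section Law

variable {T W : ℕ} [NeZero T] {Ω : Type*} [MeasurableSpace Ω] {μ : Measure Ω}
  [IsProbabilityMeasure μ]

section Single

variable {Y : Ω → Trajectory T (Fin T × Fin W) (Fin 2)}

lemma integral_comp_of_law (hY : Measurable Y) (hlaw : ∀ τ, μ.real (Y ⁻¹' {τ}) = layeredProb τ)
    (φ : Trajectory T (Fin T × Fin W) (Fin 2) → ℝ) :
    ∫ ω, φ (Y ω) ∂μ = ∑ τ, layeredProb τ * φ τ := by
  have := Measure.isProbabilityMeasure_map (μ := μ) hY.aemeasurable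
  rw [← integral_map hY.aemeasurable (f := φ) AEStronglyMeasurable.of_discrete,
    integral_fintype Integrable.of_finite]
  refine Finset.sum_congr rfl fun τ _ => ?_
  rw [map_measureReal_apply hY (measurableSet_singleton τ), hlaw, smul_eq_mul]

lemma ae_isLayered_of_law (hlaw : ∀ τ, μ.real (Y ⁻¹' {τ}) = layeredProb τ) :
    ∀ᵐ ω ∂μ, IsLayered (Y ω) := by
  have h : ∀ τ : Trajectory T (Fin T × Fin W) (Fin 2), ∀ᵐ ω ∂μ, ¬ IsLayered τ → Y ω ≠ τ := by
    intro τ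
    by_cases hτ : IsLayered τ
    · simp [hτ]
    · have h0 : layeredProb τ = 0 := by
        by_contra h
        exact hτ (isLayered_of_layeredProb_ne_zero h)
      rw [← hlaw, measureReal_eq_zero_iff] at h0
      filter_upwards [measure_eq_zero_iff_ae_notMem.mp h0] with ω hω _
      exact hω
  filter_upwards [ae_all_iff.mpr h] with ω hω
  by_contra h'
  exact hω _ h' rfl

lemma integral_indicator_of_law (hY : Measurable Y)
    (hlaw : ∀ τ, μ.real (Y ⁻¹' {τ}) = layeredProb τ) (hW : (W : ℝ) ≠ 0) (A : Finset (Fin T))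
    (g : Fin T → Fin W) {φ : Trajectory T (Fin T × Fin W) (Fin 2) → ℝ}
    (hφ : ∀ f, φ (layeredTrajectory f) = if ∀ u ∈ A, f.1 u = g u then 1 else 0) :
    ∫ ω, φ (Y ω) ∂μ = (1 / (W : ℝ)) ^ A.card := by
  rw [integral_comp_of_law hY hlaw, sum_layeredProb_mul, ← sum_uniform_indicator hW A g]
  refine Finset.sum_congr rfl fun f _ => ?_
  rw [Fin.sum_univ_two, hφ, hφ]
  ring

lemma integral_visits (hY : Measurable Y) (hlaw : ∀ τ, μ.real (Y ⁻¹' {τ}) = layeredProb τ)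
    (s : Fin T × Fin W) : ∫ ω, visits s (Y ω) ∂μ = 1 / (W : ℝ) := by
  have hW : (W : ℝ) ≠ 0 := by have := s.2.pos; positivity
  rw [integral_indicator_of_law hY hlaw hW {s.1} (fun _ => s.2), Finset.card_singleton, pow_one]
  intro f
  rw [(isLayered_layeredTrajectory f).visits_eq]
  simp [layeredTrajectory, Prod.ext_iff]

lemma integral_transitions (hY : Measurable Y)
    (hlaw : ∀ τ, μ.real (Y ⁻¹' {τ}) = layeredProb τ) (s s' : Fin T × Fin W) :
    ∫ ω, transitions s s' (Y ω) ∂μ = 1 / (W : ℝ) * layeredQ T W s s' := by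
  have hW : (W : ℝ) ≠ 0 := by have := s.2.pos; positivity
  have heq : ∀ f, transitions s s' (layeredTrajectory f) =
      if (layeredTrajectory f).1 s.1 = s ∧ ∃ h : s.1.val + 1 < T,
        (layeredTrajectory f).1 ⟨s.1.val + 1, h⟩ = s' then 1 else 0 := fun f =>
    (isLayered_layeredTrajectory f).sum_visit s fun u =>
      ∃ h : u.val + 1 < T, (layeredTrajectory f).1 ⟨u.val + 1, h⟩ = s'
  by_cases h : s'.1.val = s.1.val + 1
  · have hne : s.1 ≠ s'.1 := fun h' => by rw [h'] at h; omega
    rw [integral_indicator_of_law hY hlaw hW {s.1, s'.1}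
      (fun u => if u = s.1 then s.2 else s'.2), Finset.card_pair hne, layeredQ, if_pos h, sq]
    intro f
    have hT : s.1.val + 1 < T := h ▸ s'.1.isLt
    have hs' : (⟨s.1.val + 1, hT⟩ : Fin T) = s'.1 := Fin.ext h.symm
    rw [heq]
    simp [layeredTrajectory, Prod.ext_iff, hT, hs', hne.symm]
  · rw [integral_comp_of_law hY hlaw, sum_layeredProb_mul, layeredQ, if_neg h, mul_zero]
    refine Finset.sum_eq_zero fun f _ => Finset.sum_eq_zero fun y _ => ?_
    rw [heq, if_neg, mul_zero]
    rintro ⟨-, hT, rfl⟩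
    exact h rfl

end Single

section Sequence

variable {X : ℕ → Ω → Trajectory T (Fin T × Fin W) (Fin 2)}

lemma tendsto_average_ae (hX : ∀ n, Measurable (X n)) (hindep : iIndepFun X μ)
    (hlaw : ∀ n τ, μ.real (X n ⁻¹' {τ}) = layeredProb τ)
    (φ : Trajectory T (Fin T × Fin W) (Fin 2) → ℝ) :
    ∀ᵐ ω ∂μ, Tendsto (fun N : ℕ => (∑ n : Fin N, φ (X n ω)) / (N : ℝ)) atTop
      (𝓝 (∫ ω, φ (X 0 ω) ∂μ)) := by
  have hφ : Measurable φ := measurable_of_finite φ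
  have hid : ∀ n, IdentDistrib (X n) (X 0) μ μ := fun n =>
    ⟨(hX n).aemeasurable, (hX 0).aemeasurable, Measure.ext_of_singleton fun τ => by
      have := Measure.isProbabilityMeasure_map (μ := μ) (hX n).aemeasurable
      have := Measure.isProbabilityMeasure_map (μ := μ) (hX 0).aemeasurable
      rw [← measureReal_eq_measureReal_iff,
        map_measureReal_apply (hX n) (measurableSet_singleton τ),
        map_measureReal_apply (hX 0) (measurableSet_singleton τ), hlaw, hlaw]⟩
  have hint : Integrable (fun ω => φ (X 0 ω)) μ := by
    have := Measure.isProbabilityMeasure_map (μ := μ) (hX 0).aemeasurable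
    exact (Integrable.of_finite (f := φ) (μ := μ.map (X 0))).comp_measurable (hX 0)
  filter_upwards [strong_law_ae_real (fun n ω => φ (X n ω)) hint
    (fun i j hij => (hindep.indepFun hij).comp hφ hφ) (fun n => (hid n).comp hφ)] with ω hω
  simpa only [Finset.sum_range] using hω

lemma tendsto_visitCount_div_ae (hX : ∀ n, Measurable (X n)) (hindep : iIndepFun X μ)
    (hlaw : ∀ n τ, μ.real (X n ⁻¹' {τ}) = layeredProb τ) (s : Fin T × Fin W) :
    ∀ᵐ ω ∂μ, Tendsto (fun N : ℕ => (visitCount (fun n : Fin N => X n ω) s : ℝ) / N) atTop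
      (𝓝 (1 / (W : ℝ))) := by
  filter_upwards [tendsto_average_ae hX hindep hlaw (visits s)] with ω hω
  rw [integral_visits (hX 0) (hlaw 0)] at hω
  simpa only [visitCount_eq_sum] using! hω

/-- Transition and visit frequencies converge by the strong law, and the quotient of their limits is
`layeredQ`. -/
lemma tendsto_empiricalQ_ae (hX : ∀ n, Measurable (X n)) (hindep : iIndepFun X μ)
    (hlaw : ∀ n τ, μ.real (X n ⁻¹' {τ}) = layeredProb τ) :
    ∀ᵐ ω ∂μ, Tendsto (fun N : ℕ => empiricalQ (fun n : Fin N => X n ω)) atTop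
      (𝓝 (layeredQ T W)) := by
  have h : ∀ s s' : Fin T × Fin W, ∀ᵐ ω ∂μ, Tendsto
      (fun N : ℕ => empiricalQ (fun n : Fin N => X n ω) s s') atTop (𝓝 (layeredQ T W s s')) := by
    intro s s'
    have hW : (0 : ℝ) < 1 / (W : ℝ) := by have := s.2.pos; positivity
    filter_upwards [tendsto_visitCount_div_ae hX hindep hlaw s,
      tendsto_average_ae hX hindep hlaw (transitions s s')] with ω hv ht
    rw [integral_transitions (hX 0) (hlaw 0)] at ht
    have := ht.div hv hW.ne'
    rw [mul_div_cancel_left₀ _ hW.ne'] at this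
    refine this.congr' ?_
    filter_upwards [hv.eventually (lt_mem_nhds hW)] with N hN
    have hN0 : (N : ℝ) ≠ 0 := by rintro h0; simp [h0] at hN
    have hc : visitCount (fun n : Fin N => X n ω) s ≠ 0 := by rintro h0; simp [h0] at hN
    rw [empiricalQ_of_visited hc, transitionCount_eq_sum]
    simp only [Pi.div_apply]
    rw [div_div_div_cancel_right₀ hN0]
    rfl
  filter_upwards [ae_all_iff.mpr fun s => ae_all_iff.mpr (h s)] with ω hω
  exact tendsto_pi_nhds.mpr fun s => tendsto_pi_nhds.mpr (hω s)

end Sequence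

end Law

/-! ### Exchanging classes; frequently visited states -/

section Data

variable {N T W : ℕ}

/-- Exchange the two classes in the `j`-th trajectory of the data. -/
def flipOutcome (j : Fin N) (D : Fin N → Trajectory T (Fin T × Fin W) (Fin 2)) :
    Fin N → Trajectory T (Fin T × Fin W) (Fin 2) :=
  fun n => ((D n).1, if n = j then Fin.rev (D n).2 else (D n).2)

lemma outcomeSign_flipOutcome_self (k : Fin 2) (j : Fin N)
    (D : Fin N → Trajectory T (Fin T × Fin W) (Fin 2)) :
    outcomeSign k (flipOutcome j D j) = -outcomeSign k (D j) := by
  have : ∀ y : Fin 2, ((if Fin.rev y = k then (1 : ℝ) else 0) - 1 / 2) =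
      -((if y = k then 1 else 0) - 1 / 2) := by
    intro y
    fin_cases y <;> fin_cases k <;> simp [Fin.rev] <;> norm_num
  simpa [outcomeSign, flipOutcome] using this (D j).2

lemma outcomeSign_flipOutcome_of_ne (k : Fin 2) {j n : Fin N} (h : n ≠ j)
    (D : Fin N → Trajectory T (Fin T × Fin W) (Fin 2)) :
    outcomeSign k (flipOutcome j D n) = outcomeSign k (D n) := by
  simp [outcomeSign, flipOutcome, h]

lemma outcomeSign_sq (k : Fin 2) (τ : Trajectory T (Fin T × Fin W) (Fin 2)) :
    outcomeSign k τ ^ 2 = 1 / 4 := by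
  unfold outcomeSign
  split_ifs <;> norm_num

lemma empiricalQ_flipOutcome (j : Fin N) (D : Fin N → Trajectory T (Fin T × Fin W) (Fin 2)) :
    empiricalQ (flipOutcome j D) = empiricalQ D := rfl

/-- Every state has at least half of its expected number of visits. -/
def AllFrequent (D : Fin N → Trajectory T (Fin T × Fin W) (Fin 2)) : Prop :=
  ∀ s, (N : ℝ) / (2 * W) ≤ visitCount D s

lemma AllFrequent.visitCount_ne_zero
    {D : Fin N → Trajectory T (Fin T × Fin W) (Fin 2)} (hD : AllFrequent D) (hN : N ≠ 0)
    (s : Fin T × Fin W) : visitCount D s ≠ 0 := by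
  have hW := s.2.pos
  have hN' := Nat.pos_of_ne_zero hN
  have h : (0 : ℝ) < visitCount D s := lt_of_lt_of_le (by positivity) (hD s)
  exact_mod_cast h.ne'

/-- The data range over a finite type, so every function of them is integrable. -/
lemma integrable_of_data {Ω : Type*} [MeasurableSpace Ω] {μ : Measure Ω}
    [IsProbabilityMeasure μ] {X : ℕ → Ω → Trajectory T (Fin T × Fin W) (Fin 2)}
    (hX : ∀ n, Measurable (X n))
    (F : (Fin N → Trajectory T (Fin T × Fin W) (Fin 2)) → ℝ) :
    Integrable (fun ω => F fun n => X n ω) μ := by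
  have hD : Measurable fun ω (n : Fin N) => X n ω := measurable_pi_iff.mpr fun n => hX n
  have := Measure.isProbabilityMeasure_map (μ := μ) hD.aemeasurable
  exact (Integrable.of_finite (f := F)).comp_measurable hD

end Data

/-! ### Second moments of signed sums; rarity of infrequent states -/

section Risk

variable {T W : ℕ} [NeZero T] {Ω : Type*} [MeasurableSpace Ω] {μ : Measure Ω}
  [IsProbabilityMeasure μ] {X : ℕ → Ω → Trajectory T (Fin T × Fin W) (Fin 2)}

/-- Given the paths, the classes are fair coins: exchanging them in one trajectory preserves
the law of the data. -/
lemma integral_flipOutcome (hX : ∀ n, Measurable (X n)) (hindep : iIndepFun X μ)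
    (hlaw : ∀ n τ, μ.real (X n ⁻¹' {τ}) = layeredProb τ) {N : ℕ} (j : Fin N)
    (F : (Fin N → Trajectory T (Fin T × Fin W) (Fin 2)) → ℝ) :
    ∫ ω, F (flipOutcome j fun n => X n ω) ∂μ = ∫ ω, F (fun n => X n ω) ∂μ := by
  have hD : Measurable fun ω (n : Fin N) => X n ω := measurable_pi_iff.mpr fun n => hX n
  have hprob : ∀ n : Fin N, IsProbabilityMeasure (μ.map (X n)) := fun n =>
    Measure.isProbabilityMeasure_map (hX n).aemeasurable
  have hmap : μ.map (fun ω (n : Fin N) => X n ω) = Measure.pi fun n : Fin N => μ.map (X n) :=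
    (iIndepFun_iff_map_fun_eq_pi_map fun n : Fin N => (hX n).aemeasurable).mp
      (hindep.precomp Fin.val_injective)
  have hpres : MeasurePreserving (flipOutcome (T := T) (W := W) j)
      (Measure.pi fun n : Fin N => μ.map (X n)) (Measure.pi fun n : Fin N => μ.map (X n)) := by
    refine measurePreserving_pi _ _ (f := fun n (τ : Trajectory T (Fin T × Fin W) (Fin 2)) =>
      ((τ.1, if n = j then Fin.rev τ.2 else τ.2) : Trajectory T (Fin T × Fin W) (Fin 2)))
      fun n => ⟨measurable_of_finite _, Measure.ext_of_singleton fun τ => ?_⟩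
    have hpre : (fun τ : Trajectory T (Fin T × Fin W) (Fin 2) =>
        (τ.1, if n = j then Fin.rev τ.2 else τ.2)) ⁻¹' {τ} =
        {(τ.1, if n = j then Fin.rev τ.2 else τ.2)} := by
      ext σ
      simp only [Set.mem_preimage, Set.mem_singleton_iff, Prod.ext_iff]
      split_ifs
      · rw [Fin.rev_eq_iff]
      · rfl
    rw [Measure.map_apply (measurable_of_finite _) (measurableSet_singleton τ), hpre,
      ← measureReal_eq_measureReal_iff, map_measureReal_apply (hX n) (measurableSet_singleton _),
      map_measureReal_apply (hX n) (measurableSet_singleton _), hlaw, hlaw]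
    -- `layeredR` ignores the class, so both trajectories have the same probability by definition.
    rfl
  rw [← hmap] at hpres
  rw [← integral_map hD.aemeasurable (f := F) AEStronglyMeasurable.of_discrete, ← hpres.map_eq,
    integral_map hpres.measurable.aemeasurable AEStronglyMeasurable.of_discrete,
    integral_map hD.aemeasurable AEStronglyMeasurable.of_discrete]

/-- Flipping the class of trajectory `i` negates the cross term of `i` and `j` while preserving the
law, so its mean is zero. On the diagonal the squared sign is 1/4. -/
lemma integral_sum_mul_outcomeSign_sq (hX : ∀ n, Measurable (X n)) (hindep : iIndepFun X μ)
    (hlaw : ∀ n τ, μ.real (X n ⁻¹' {τ}) = layeredProb τ) (k : Fin 2) {N : ℕ}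
    {a : Fin N → (Fin N → Trajectory T (Fin T × Fin W) (Fin 2)) → ℝ}
    (ha : ∀ n j D, a n (flipOutcome j D) = a n D) :
    ∫ ω, (∑ n, a n (fun n => X n ω) * outcomeSign k (X n ω)) ^ 2 ∂μ =
      1 / 4 * ∫ ω, ∑ n, a n (fun n => X n ω) ^ 2 ∂μ := by
  have hcross : ∀ i j : Fin N, i ≠ j → ∫ ω, a i (fun n => X n ω) * outcomeSign k (X i ω) *
      (a j (fun n => X n ω) * outcomeSign k (X j ω)) ∂μ = 0 := by
    intro i j hij
    have h := integral_flipOutcome hX hindep hlaw i fun D =>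
      a i D * outcomeSign k (D i) * (a j D * outcomeSign k (D j))
    simp only [ha, outcomeSign_flipOutcome_self, outcomeSign_flipOutcome_of_ne k hij.symm,
      mul_neg, neg_mul, integral_neg] at h
    linarith
  have hint : ∀ i j : Fin N, Integrable (fun ω => a i (fun n => X n ω) * outcomeSign k (X i ω) *
      (a j (fun n => X n ω) * outcomeSign k (X j ω))) μ := fun i j =>
    integrable_of_data hX fun D => a i D * outcomeSign k (D i) * (a j D * outcomeSign k (D j))
  simp only [sq (Finset.sum _ _), Finset.sum_mul_sum]
  rw [integral_finsetSum _ fun i _ => integrable_finsetSum _ fun j _ => hint i j,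
    integral_finsetSum _ fun i _ => integrable_of_data hX fun D => a i D ^ 2, Finset.mul_sum]
  refine Finset.sum_congr rfl fun i _ => ?_
  rw [integral_finsetSum _ fun j _ => hint i j,
    Finset.sum_eq_single i (fun j _ hj => hcross i j hj.symm) (by simp), ← integral_const_mul]
  congr with ω
  rw [← outcomeSign_sq k (X i ω)]
  ring

/-- Hoeffding's inequality for visit indicators, which have sub-Gaussian parameter 1/4. The
deviation is half the mean `N / W`. -/
lemma measureReal_visitCount_lt_le (hX : ∀ n, Measurable (X n)) (hindep : iIndepFun X μ)
    (hlaw : ∀ n τ, μ.real (X n ⁻¹' {τ}) = layeredProb τ) (s : Fin T × Fin W) (N : ℕ) :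
    μ.real {ω | (visitCount (fun n : Fin N => X n ω) s : ℝ) < N / (2 * W)} ≤
      Real.exp (-(1 / (2 * W ^ 2) * N)) := by
  have hW : (0 : ℝ) < W := by have := s.2.pos; positivity
  have hsub : ∀ n, HasSubgaussianMGF
      (fun ω => -visits s (X n ω) + 1 / W) ((‖(0 : ℝ) - (-1)‖₊ / 2) ^ 2) μ := by
    intro n
    have h := hasSubgaussianMGF_of_mem_Icc (μ := μ) (X := fun ω => -visits s (X n ω))
      (a := -1) (b := 0) ((measurable_of_finite fun τ => -visits s τ).comp (hX n)).aemeasurable (by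
        filter_upwards [ae_isLayered_of_law (hlaw n)] with ω hω
        rw [hω.visits_eq]
        split_ifs <;> simp)
    rw [integral_neg, integral_visits (hX n) (hlaw n)] at h
    simpa only [sub_neg_eq_add] using h
  have hind : iIndepFun (fun n ω => -visits s (X n ω) + 1 / W) μ :=
    hindep.comp (fun _ τ => -visits s τ + 1 / W) fun _ => measurable_of_finite _
  have h := HasSubgaussianMGF.measure_sum_range_ge_le_of_iIndepFun hind
    (fun n (_ : n < N) => hsub n) (ε := N / (2 * W)) (by positivity)
  refine (measureReal_mono fun ω hω => ?_).trans (h.trans (le_of_eq ?_))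
  · simp only [Set.mem_ofPred_eq] at hω ⊢
    rw [Finset.sum_add_distrib, Finset.sum_neg_distrib, Finset.sum_const, Finset.card_range,
      nsmul_eq_mul, Finset.sum_range]
    rw [visitCount_eq_sum] at hω
    change ∑ n : Fin N, visits s (X n ω) < _ at hω
    have : (N : ℝ) * (1 / W) = N / (2 * W) + N / (2 * W) := by field_simp; norm_num
    linarith
  · congr 1
    by_cases hN : (N : ℝ) = 0
    · simp [hN]
    · simp
      field_simp

/-- A union bound over the finitely many states; the exponential decay absorbs the factor `N`. -/
lemma tendsto_mul_measureReal_not_allFrequent (hX : ∀ n, Measurable (X n))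
    (hindep : iIndepFun X μ) (hlaw : ∀ n τ, μ.real (X n ⁻¹' {τ}) = layeredProb τ)
    (hW : 0 < W) :
    Tendsto (fun N : ℕ => (N : ℝ) * μ.real {ω | ¬ AllFrequent fun n : Fin N => X n ω}) atTop
      (𝓝 0) := by
  set c : ℝ := 1 / (2 * W ^ 2) with hc
  have hcpos : 0 < c := by positivity
  have hlim : Tendsto (fun N : ℕ => Fintype.card (Fin T × Fin W) / c *
      ((c * N) ^ 1 * Real.exp (-(c * N)))) atTop (𝓝 0) := by
    have := (Real.tendsto_pow_mul_exp_neg_atTop_nhds_zero 1).comp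
      (tendsto_natCast_atTop_atTop.const_mul_atTop hcpos)
    simpa using this.const_mul (Fintype.card (Fin T × Fin W) / c)
  refine squeeze_zero (fun N => by positivity) (fun N => ?_) hlim
  have hset : {ω | ¬ AllFrequent fun n : Fin N => X n ω} =
      ⋃ s : Fin T × Fin W, {ω | (visitCount (fun n : Fin N => X n ω) s : ℝ) < N / (2 * W)} := by
    ext ω
    simp [AllFrequent]
  have hle : μ.real {ω | ¬ AllFrequent fun n : Fin N => X n ω} ≤
      Fintype.card (Fin T × Fin W) * Real.exp (-(c * N)) := by
    rw [hset]
    refine (measureReal_iUnion_fintype_le _).trans ?_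
    refine (Finset.sum_le_sum fun s _ => measureReal_visitCount_lt_le hX hindep hlaw s N).trans ?_
    simp [hc]
  calc (N : ℝ) * μ.real {ω | ¬ AllFrequent fun n : Fin N => X n ω}
      ≤ N * (Fintype.card (Fin T × Fin W) * Real.exp (-(c * N))) := by gcongr
    _ = _ := by field_simp

end Risk

/-! ### Limit of the normalized mean squared error -/

section Asymptotics

variable {T W : ℕ} [NeZero T] {Ω : Type*} [MeasurableSpace Ω] {μ : Measure Ω}
  [IsProbabilityMeasure μ] {X : ℕ → Ω → Trajectory T (Fin T × Fin W) (Fin 2)}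

open Classical in
/-- The dominated convergence step: the normalized sum of the squared weights. -/
lemma tendsto_integral_sum_weight_sq (hX : ∀ n, Measurable (X n)) (hindep : iIndepFun X μ)
    (hlaw : ∀ n τ, μ.real (X n ⁻¹' {τ}) = layeredProb τ) (hW : 0 < W)
    {w : ∀ N, (Fin N → Trajectory T (Fin T × Fin W) (Fin 2)) → Fin T × Fin W → ℝ}
    {w' : Fin T × Fin W → ℝ} (hw_nonneg : ∀ N D s, 0 ≤ w N D s) (hw_le : ∀ N D s, w N D s ≤ 1)
    (hw_lim : ∀ᵐ ω ∂μ, ∀ s, Tendsto (fun N => w N (fun n => X n ω) s) atTop (𝓝 (w' s))) :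
    Tendsto (fun N : ℕ => ∫ ω, (N : ℝ) * (if AllFrequent fun n : Fin N => X n ω then
      ∑ s, w N (fun n => X n ω) s ^ 2 / visitCount (fun n : Fin N => X n ω) s else 0) ∂μ) atTop
      (𝓝 (W * ∑ s, w' s ^ 2)) := by
  have hWpos : (0 : ℝ) < W := by exact_mod_cast hW
  have hconst : W * ∑ s, w' s ^ 2 = ∫ _ω, W * ∑ s, w' s ^ 2 ∂μ := by simp
  rw [hconst]
  -- On `AllFrequent` data `N / visitCount` is at most `2 * W`, and weights are at most 1.
  refine tendsto_integral_of_dominated_convergence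
    (fun _ => ∑ _s : Fin T × Fin W, (2 * W : ℝ)) (fun N => ?_) (integrable_const _)
    (fun N => ae_of_all _ fun ω => ?_) ?_
  · exact (integrable_of_data hX fun D => (N : ℝ) * (if AllFrequent D then
      ∑ s, w N D s ^ 2 / visitCount D s else 0)).aestronglyMeasurable
  · split_ifs with h
    · rw [Real.norm_of_nonneg (by positivity), Finset.mul_sum]
      refine Finset.sum_le_sum fun s _ => ?_
      have h1 : w N (fun n => X n ω) s ^ 2 ≤ 1 := pow_le_one₀ (hw_nonneg N _ s) (hw_le N _ s)
      -- For `N = 0`, `AllFrequent` holds with all counts zero.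
      rcases Nat.eq_zero_or_pos N with hN | hN
      · simp only [hN, Nat.cast_zero, zero_mul]
        positivity
      · have hc : (0 : ℝ) < visitCount (fun n : Fin N => X n ω) s := by
          exact_mod_cast Nat.pos_of_ne_zero (h.visitCount_ne_zero hN.ne' s)
        have h2 := h s
        rw [div_le_iff₀ (by positivity)] at h2
        rw [← mul_div_assoc, div_le_iff₀ hc]
        calc (N : ℝ) * w N (fun n => X n ω) s ^ 2 ≤ N * 1 := by gcongr
          _ ≤ _ := by linarith
    · simp only [mul_zero, norm_zero]
      positivity
  · filter_upwards [hw_lim, ae_all_iff.mpr fun s => tendsto_visitCount_div_ae hX hindep hlaw s]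
      with ω hω hv
    have hgood : ∀ᶠ N : ℕ in atTop, AllFrequent fun n : Fin N => X n ω := by
      refine (eventually_all.mpr fun s => ?_ :
        ∀ᶠ N : ℕ in atTop, ∀ s, (N : ℝ) / (2 * W) ≤ visitCount (fun n : Fin N => X n ω) s)
      have hlt : 1 / (2 * W : ℝ) < 1 / W := by
        apply one_div_lt_one_div_of_lt hWpos
        linarith
      filter_upwards [(hv s).eventually (lt_mem_nhds hlt), eventually_gt_atTop 0] with N hN hN0
      have hN0' : (0 : ℝ) < N := by exact_mod_cast hN0
      rw [lt_div_iff₀ hN0'] at hN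
      calc (N : ℝ) / (2 * W) = 1 / (2 * W) * N := by ring
        _ ≤ _ := hN.le
    have hlim : Tendsto (fun N : ℕ => ∑ s, w N (fun n => X n ω) s ^ 2 /
        ((visitCount (fun n : Fin N => X n ω) s : ℝ) / N)) atTop (𝓝 (W * ∑ s, w' s ^ 2)) := by
      have : W * ∑ s, w' s ^ 2 = ∑ s, w' s ^ 2 / (1 / (W : ℝ)) := by
        rw [Finset.mul_sum]
        refine Finset.sum_congr rfl fun s _ => ?_
        field_simp
      rw [this]
      exact tendsto_finsetSum _ fun s _ => ((hω s).pow 2).div (hv s) (by positivity)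
    refine hlim.congr' ?_
    filter_upwards [hgood] with N hN
    rw [if_pos hN, Finset.mul_sum]
    refine Finset.sum_congr rfl fun s _ => ?_
    rw [div_div_eq_mul_div, mul_div_assoc']
    ring

/-- Asymptotic mean squared error of an estimator of `1 / 2` which, on data in which every state
occurs, is a weighted average of the outcomes. -/
lemma tendsto_mul_integral_sq_sub_half (hX : ∀ n, Measurable (X n)) (hindep : iIndepFun X μ)
    (hlaw : ∀ n τ, μ.real (X n ⁻¹' {τ}) = layeredProb τ) (hW : 0 < W) (k : Fin 2) (u : Fin T)
    {est : ∀ N, (Fin N → Trajectory T (Fin T × Fin W) (Fin 2)) → ℝ}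
    {w : ∀ N, (Fin N → Trajectory T (Fin T × Fin W) (Fin 2)) → Fin T × Fin W → ℝ}
    {w' : Fin T × Fin W → ℝ} (hw_flip : ∀ N j D, w N (flipOutcome j D) = w N D)
    (hw_nonneg : ∀ N D s, 0 ≤ w N D s) (hw_le : ∀ N D s, w N D s ≤ 1)
    (hw_supp : ∀ N D, (∀ n, IsLayered (D n)) → (∀ s, visitCount D s ≠ 0) →
      ∀ s, s.1 ≠ u → w N D s = 0)
    (hw_lim : ∀ᵐ ω ∂μ, ∀ s, Tendsto (fun N => w N (fun n => X n ω) s) atTop (𝓝 (w' s)))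
    (hest_mem : ∀ N D, (∀ n, IsLayered (D n)) → est N D ∈ Set.Icc (0 : ℝ) 1)
    (hest : ∀ N D, (∀ n, IsLayered (D n)) → (∀ s, visitCount D s ≠ 0) →
      est N D - 1 / 2 = weightedOutcome k u (w N D) D) :
    Tendsto (fun N : ℕ => (N : ℝ) * ∫ ω, (est N (fun n => X n ω) - 1 / 2) ^ 2 ∂μ) atTop
      (𝓝 (1 / 4 * (W * ∑ s, w' s ^ 2))) := by
  classical
  have hlay : ∀ᵐ ω ∂μ, ∀ n, IsLayered (X n ω) := ae_all_iff.mpr fun n =>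
    ae_isLayered_of_law (hlaw n)
  have hmain := (tendsto_integral_sum_weight_sq hX hindep hlaw hW hw_nonneg hw_le hw_lim).const_mul
    (1 / 4)
  -- Off the frequent event the squared error is still at most 1, as the estimate stays in the unit
  -- interval.
  have hbad : Tendsto (fun N : ℕ => (N : ℝ) * ∫ ω, (if AllFrequent fun n : Fin N => X n ω then 0
      else (est N (fun n => X n ω) - 1 / 2) ^ 2) ∂μ) atTop (𝓝 0) := by
    refine squeeze_zero (fun N => mul_nonneg (by positivity) (integral_nonneg fun ω => ?_))
      (fun N => ?_) (tendsto_mul_measureReal_not_allFrequent hX hindep hlaw hW)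
    · simp only [Pi.zero_apply]
      split_ifs <;> positivity
    · refine mul_le_mul_of_nonneg_left ?_ (by positivity)
      have hmeas : MeasurableSet {ω | ¬ AllFrequent fun n : Fin N => X n ω} :=
        (measurable_pi_iff.mpr fun n : Fin N => hX n)
          (MeasurableSet.of_discrete (s := {D | ¬ AllFrequent D}))
      rw [← integral_indicator_one hmeas]
      refine integral_mono_ae (integrable_of_data hX fun D => if AllFrequent D then 0
        else (est N D - 1 / 2) ^ 2) ((integrable_const 1).indicator hmeas) ?_
      filter_upwards [hlay] with ω hω
      by_cases h : AllFrequent fun n : Fin N => X n ω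
      · simp [h]
      · obtain ⟨h0, h1⟩ := hest_mem N (fun n => X n ω) fun n => hω n
        simp only [h, if_false, Set.indicator, Set.mem_ofPred_eq, not_false_eq_true, if_true,
          Pi.one_apply]
        nlinarith
  rw [← add_zero (1 / 4 * _)]
  refine (hmain.add hbad).congr' ?_
  filter_upwards [eventually_ne_atTop 0] with N hN
  -- Truncating to `AllFrequent` keeps the weights functions of the paths alone, hence invariant
  -- under flips.
  let a : Fin N → (Fin N → Trajectory T (Fin T × Fin W) (Fin 2)) → ℝ := fun n D =>
    if AllFrequent D then w N D ((D n).1 u) / visitCount D ((D n).1 u) else 0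
  have ha : ∀ n j D, a n (flipOutcome j D) = a n D := by
    intro n j D
    simp only [a, hw_flip]
    rfl
  have hsum : ∫ ω, ∑ n, a n (fun n => X n ω) ^ 2 ∂μ =
      ∫ ω, (if AllFrequent fun n : Fin N => X n ω then
        ∑ s, w N (fun n => X n ω) s ^ 2 / visitCount (fun n : Fin N => X n ω) s else 0) ∂μ := by
    refine integral_congr_ae ?_
    filter_upwards [hlay] with ω hω
    by_cases h : AllFrequent fun n : Fin N => X n ω
    · simp only [a, h, if_true]
      exact sum_weight_sq (D := fun n : Fin N => X n ω) (fun n => hω n)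
        (hw_supp N _ (fun n => hω n) (h.visitCount_ne_zero hN))
    · simp [a, h]
  have hsplit : ∫ ω, (est N (fun n => X n ω) - 1 / 2) ^ 2 ∂μ =
      ∫ ω, (∑ n, a n (fun n => X n ω) * outcomeSign k (X n ω)) ^ 2 ∂μ +
      ∫ ω, (if AllFrequent fun n : Fin N => X n ω then 0
        else (est N (fun n => X n ω) - 1 / 2) ^ 2) ∂μ := by
    rw [← integral_add (integrable_of_data hX fun D => (∑ n, a n D * outcomeSign k (D n)) ^ 2)
      (integrable_of_data hX fun D => if AllFrequent D then 0 else (est N D - 1 / 2) ^ 2)]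
    refine integral_congr_ae ?_
    filter_upwards [hlay] with ω hω
    by_cases h : AllFrequent fun n : Fin N => X n ω
    · simp only [a, h, if_true, add_zero]
      rw [hest N _ (fun n => hω n) (h.visitCount_ne_zero hN)]
      rfl
    · simp [a, h]
  rw [hsplit, integral_sum_mul_outcomeSign_sq hX hindep hlaw k ha, hsum, integral_const_mul]
  ring

end Asymptotics

theorem proposition3 (T W : ℕ) [NeZero T] (hTW : T = 1 → W = 1)
    {Ω : Type*} [MeasurableSpace Ω] (μ : Measure Ω) [IsProbabilityMeasure μ]
    (X : ℕ → Ω → Trajectory T (Fin T × Fin W) (Fin 2))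
    (hX_meas : ∀ n, Measurable (X n))
    (hX_indep : iIndepFun X μ)
    (hX_law : ∀ n τ, μ.real (X n ⁻¹' {τ}) =
      trajectoryProb (layeredInit T W) (layeredQ T W) (layeredR T W) τ)
    (Pdir Pind : Matrix (Fin T × Fin W) (Fin 2) ℝ)
    (hPdir : IsRowStochastic Pdir) (hPind : IsRowStochastic Pind)
    (m : Fin W) (k : Fin 2) :
    Tendsto
      (fun N : ℕ =>
        (∫ ω, (indirectEstimate Pind (fun n : Fin N => X n ω) (0, m) k
            - absorptionProb (layeredQ T W) (layeredR T W) (0, m) k) ^ 2 ∂μ) /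
        (∫ ω, (directEstimate Pdir (fun n : Fin N => X n ω) (0, m) k
            - absorptionProb (layeredQ T W) (layeredR T W) (0, m) k) ^ 2 ∂μ))
      atTop (𝓝 (1 / (W : ℝ))) := by
  have hW : 0 < W := m.pos
  have hWpos : (0 : ℝ) < W := by exact_mod_cast hW
  have hT : T - 1 + 1 = T := Nat.sub_add_cancel (NeZero.pos T)
  simp only [absorptionProb_layered]
  have hdir := tendsto_mul_integral_sq_sub_half hX_meas hX_indep hX_law hW k 0
    (est := fun N D => directEstimate Pdir D (0, m) k)
    (w := fun _ _ s => if s = (0, m) then 1 else 0) (w' := fun s => if s = (0, m) then 1 else 0)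
    (fun _ _ _ => rfl) (fun _ _ s => by split_ifs <;> norm_num)
    (fun _ _ s => by split_ifs <;> norm_num)
    (fun _ _ _ _ s hs => if_neg fun h => hs (by rw [h])) (ae_of_all _ fun _ _ => tendsto_const_nhds)
    (fun _ D _ => directEstimate_mem_Icc hPdir D (0, m) k)
    (fun _ D hD hv => directEstimate_sub_half hD (hv (0, m)) Pdir k)
  have hind := tendsto_mul_integral_sq_sub_half hX_meas hX_indep hX_law hW k
    ⟨T - 1, Nat.sub_lt (NeZero.pos T) one_pos⟩
    (est := fun N D => indirectEstimate Pind D (0, m) k)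
    (w := fun _ D s => (empiricalQ D ^ (T - 1)) (0, m) s)
    (w' := fun s => (layeredQ T W ^ (T - 1)) (0, m) s)
    (fun _ j D => by rw [empiricalQ_flipOutcome])
    (fun _ D s => pow_nonneg_of_entries_nonneg (empiricalQ_nonneg D) _ _ s)
    (fun _ D s => pow_entry_le_one (empiricalQ_nonneg D) (sum_empiricalQ_le_one D k) _ _ s)
    (fun _ D hD hv s hs => pow_eq_zero_of_layer_ne (ℓ := fun s => s.1.val)
      (fun s s' h => empiricalQ_eq_zero_of_layer_ne hD (hv s) s' h) _
      fun h => hs (Fin.ext (by simpa using h)))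
    (by
      filter_upwards [tendsto_empiricalQ_ae hX_meas hX_indep hX_law] with ω hω s
      exact tendsto_pi_nhds.mp (tendsto_pi_nhds.mp (hω.pow (T - 1)) (0, m)) s)
    (fun _ D hD => indirectEstimate_mem_Icc hD hPind (0, m) k)
    (fun _ D hD hv => indirectEstimate_sub_half hD hv Pind k hT (by simp))
  rw [sum_layeredQ_pow_sq hTW] at hind
  have hdir_sum : ∑ s : Fin T × Fin W, (if s = (0, m) then (1 : ℝ) else 0) ^ 2 = 1 := by simp
  rw [hdir_sum] at hdir
  have hratio := hind.div hdir (by positivity)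
  have hval : 1 / 4 * (W * (1 / W)) / (1 / 4 * (W * 1)) = 1 / (W : ℝ) := by field_simp
  rw [hval] at hratio
  -- The normalizing factor `N` cancels in the ratio.
  refine hratio.congr' ?_
  filter_upwards [eventually_ne_atTop 0] with N hN
  exact mul_div_mul_left _ _ (Nat.cast_ne_zero.mpr hN)
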